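/- Let $L\ge 2$ be an integer and let $P,N>0$ be real numbers with $N\le\frac{L-1}{L}P$. For a finite list $\mathcal L\subset\mathbb R^n$ let $\mathrm{rad}^2(\mathcal L)=\min_{y\in\mathbb R^n}\max_{x\in\mathcal L}\|x-y\|_2^2$ be its squared Chebyshev radius, and for a code $\mathcal C\subset\mathbb R^n$ let $\mathrm{rad}_L^2(\mathcal C)$ be the infimum of $\mathrm{rad}^2(\mathcal L)$ over all $L$-element subsets $\mathcal L$ of $\mathcal C$ (it is $+\infty$ if $|\mathcal C|<L$). A $(P,N,L-1)$-multiple packing is a set $\mathcal C\subseteq\{x\in\mathbb R^n:\|x\|_2\le\sqrt{nP}\}$ with $\mathrm{rad}_L^2(\mathcal C)>nN$; equivalently, every closed ball of radius $\sqrt{nN}$ in $\mathbb R^n$ contains at most $L-1$ points of $\mathcal C$. Its rate is $R(\mathcal C)=\frac1n\ln|\mathcal C|$, and the $(P,N,L-1)$-list-decoding capacity (bounded multiple-packing capacity) is $$C_{L-1}(P,N)=\limsup_{n\to\infty}\ \sup\{R(\mathcal C):\mathcal C\subset\mathbb R^n\text{ is a }(P,N,L-1)\text{-multiple packing}\}.$$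 Then $$C_{L-1}(P,N)\ \ge\ \frac12\left[\ln\frac{(L-1)P}{LN}+\frac1{L-1}\ln\frac{P}{L(P-N)}\right].$$ -/

import Mathlib

open scoped ENNReal

noncomputable section

namespace MultiplePacking

/-- The squared Chebyshev radius of a finite list of points: the infimum over all centres `y` of
the largest squared distance from `y` to a point of the list. -/
def chebRadSq {n : ℕ} (S : Finset (EuclideanSpace ℝ (Fin n))) : ℝ≥0∞ :=
  ⨅ y : EuclideanSpace ℝ (Fin n), ⨆ x ∈ S, ENNReal.ofReal (‖x - y‖ ^ 2)

/-- The squared `(L - 1)`-list-decoding radius of a code `C`: the smallest squared Chebyshev radius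
of an `L`-element subset of `C`. It is `⊤` if `C` has fewer than `L` points. -/
def listRadSq {n : ℕ} (L : ℕ) (C : Set (EuclideanSpace ℝ (Fin n))) : ℝ≥0∞ :=
  ⨅ (S : Finset (EuclideanSpace ℝ (Fin n))) (_ : (S : Set (EuclideanSpace ℝ (Fin n))) ⊆ C)
    (_ : S.card = L), chebRadSq S

/-- The rate `(1 / n) ln |C|` of a bounded code, as an extended real
(the logarithm of `0` is `-∞` and that of `∞` is `∞`). -/
def rate {n : ℕ} (C : Set (EuclideanSpace ℝ (Fin n))) : EReal :=
  ENNReal.log (C.encard : ℝ≥0∞) / (n : EReal)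

/-- `C` is a `(P, N, L - 1)`-multiple packing: it lies in the closed ball of radius `√(nP)` about
the origin and its squared `(L - 1)`-list-decoding radius exceeds `nN`. -/
def IsMultiplePacking {n : ℕ} (P N : ℝ) (L : ℕ) (C : Set (EuclideanSpace ℝ (Fin n))) : Prop :=
  C ⊆ Metric.closedBall 0 (Real.sqrt (n * P)) ∧ ENNReal.ofReal (n * N) < listRadSq L C

/-- The `(P, N, L - 1)`-list-decoding capacity `C_{L-1}(P, N)`. The argument is `L`, the size of
the lists whose Chebyshev radius is constrained. -/
def capacity (P N : ℝ) (L : ℕ) : EReal :=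
  Filter.limsup
    (fun n : ℕ => ⨆ (C : Set (EuclideanSpace ℝ (Fin n))) (_ : IsMultiplePacking P N L C), rate C)
    Filter.atTop

end MultiplePacking

end

open scoped ENNReal

open MeasureTheory ProbabilityTheory Finset

namespace MultiplePacking

/-! Random coding with expurgation, in even dimensions `n = 2m`. Codewords are independent and
uniform in the ball. The squared Chebyshev radius of `L` points is at least `spread / L`, so lists
of small spread are the only danger. By `exp_neg_spread_eq_lintegral`, `exp (-s * spread)` is a
Gaussian average over a centre `y` of a product over the points, so its expectation factors. The
resulting Chernoff bound (`measure_spread_le_pow`) is polynomial in `m` times `(B * A ^ (L - 1))⁻¹ ^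
m`, with `A = (L-1)P/(LN)` and `B = P/(L(P-N))`. About `exp (nR)` codewords survive expurgation
(`exists_expurgated`) once `exp (2R(L-1)) < B * A ^ (L-1)`, which is the claimed rate. -/

lemma lintegral_pi_prod {E : Type*} [MeasurableSpace E] {L : ℕ} (μ : Measure E) [IsProbabilityMeasure μ] {f : E → ℝ≥0∞}
    (hf : Measurable f) :
    ∫⁻ x : Fin L → E, ∏ i, f (x i) ∂(Measure.pi fun _ ↦ μ) = (∫⁻ x, f x ∂μ) ^ L := by
  rw [lintegral_prod_eq_prod_lintegral_of_indepFun univ (fun i (x : Fin L → E) ↦ f (x i))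
    (iIndepFun_pi fun _ ↦ hf.aemeasurable) fun i ↦ hf.comp (measurable_pi_apply i)]
  simp_rw [fun i : Fin L ↦ (measurePreserving_eval (fun _ : Fin L ↦ μ) i).lintegral_comp hf]
  simp

/-! ### Spread and its Gaussian linearization. -/

section Spread

variable {E : Type*} [NormedAddCommGroup E] [InnerProductSpace ℝ E]

/-- The sum of the squared distances of the points `x i` to their mean. -/
noncomputable def spread {L : ℕ} (x : Fin L → E) : ℝ :=
  ∑ i, ‖x i - (L : ℝ)⁻¹ • ∑ j, x j‖ ^ 2

/-- Parallel axis identity: the cross terms vanish because deviations from the mean sum to zero. -/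
lemma sum_norm_sub_sq {L : ℕ} (hL : 0 < L) (x : Fin L → E) (y : E) :
    ∑ i, ‖x i - y‖ ^ 2 = spread x + L * ‖y - (L : ℝ)⁻¹ • ∑ j, x j‖ ^ 2 := by
  have hL' : (L : ℝ) ≠ 0 := by positivity
  set c := (L : ℝ)⁻¹ • ∑ j, x j with hc
  have hsum : ∑ i, (x i - c) = 0 := by
    rw [sum_sub_distrib, sum_const, card_univ, Fintype.card_fin, ← Nat.cast_smul_eq_nsmul ℝ, hc,
      smul_smul, mul_inv_cancel₀ hL', one_smul, sub_self]
  have h (i : Fin L) : ‖x i - y‖ ^ 2 =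
      ‖x i - c‖ ^ 2 - 2 * inner ℝ (x i - c) (y - c) + ‖y - c‖ ^ 2 := by
    rw [← norm_sub_sq_real]
    congr 2
    abel
  simp_rw [h, sum_add_distrib, sum_sub_distrib, ← mul_sum, ← sum_inner, hsum]
  simp [spread, ← hc]

lemma continuous_spread {L : ℕ} : Continuous (spread : (Fin L → E) → ℝ) := by
  unfold spread
  fun_prop

variable [FiniteDimensional ℝ E] [MeasurableSpace E] [BorelSpace E]

lemma lintegral_exp_neg_mul_norm_sq {m : ℕ} (hE : Module.finrank ℝ E = 2 * m) {a : ℝ}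
    (ha : 0 < a) (z : E) :
    ∫⁻ x : E, ENNReal.ofReal (Real.exp (-a * ‖x - z‖ ^ 2)) =
      ENNReal.ofReal ((Real.pi / a) ^ m) := by
  rw [lintegral_sub_right_eq_self (fun x : E ↦ ENNReal.ofReal (Real.exp (-a * ‖x‖ ^ 2))) z]
  have h := GaussianFourier.integral_rexp_neg_mul_sq_norm (V := E) ha
  have hm : ((Module.finrank ℝ E : ℝ) / 2) = (m : ℕ) := by rw [hE]; push_cast; ring
  rw [hm, Real.rpow_natCast] at h
  rw [← h, ofReal_integral_eq_lintegral_ofReal _ (.of_forall fun _ ↦ (Real.exp_pos _).le)]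
  -- A non-integrable function would have integral `0` by convention, against the positive value in
  -- `h`.
  by_contra hi
  rw [integral_undef hi] at h
  exact absurd h (by have := Real.pi_pos; positivity)

/-- Decouples the points: for fixed `y` the integrand is a product, and integrating out the distance
from `y` to the mean only costs a constant. -/
lemma exp_neg_spread_eq_lintegral {m L : ℕ} (hL : 0 < L) (hE : Module.finrank ℝ E = 2 * m) {s : ℝ}
    (hs : 0 < s) (x : Fin L → E) :
    ENNReal.ofReal (Real.exp (-s * spread x)) = ENNReal.ofReal ((s * L / Real.pi) ^ m) *
      ∫⁻ y : E, ∏ i, ENNReal.ofReal (Real.exp (-s * ‖x i - y‖ ^ 2)) := by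
  have hpi := Real.pi_pos
  have h (y : E) : ∏ i, ENNReal.ofReal (Real.exp (-s * ‖x i - y‖ ^ 2)) =
      ENNReal.ofReal (Real.exp (-s * spread x)) *
        ENNReal.ofReal (Real.exp (-(s * L) * ‖y - (L : ℝ)⁻¹ • ∑ j, x j‖ ^ 2)) := by
    rw [← ENNReal.ofReal_prod_of_nonneg fun _ _ ↦ (Real.exp_pos _).le, ← Real.exp_sum, ← mul_sum,
      sum_norm_sub_sq hL, ← ENNReal.ofReal_mul (Real.exp_pos _).le, ← Real.exp_add]
    ring_nf
  simp_rw [h]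
  rw [lintegral_const_mul _ (by fun_prop),
    lintegral_exp_neg_mul_norm_sq hE (by positivity), mul_left_comm,
    ← ENNReal.ofReal_mul (by positivity), ← mul_pow]
  have : s * L / Real.pi * (Real.pi / (s * L)) = 1 := by field_simp
  rw [this]
  simp

/-! ### Uniform points in a ball and the Chernoff bound. -/

/-- The uniform probability measure on the closed ball of squared radius `ρ`. -/
noncomputable def uniformBall (E : Type*) [NormedAddCommGroup E] [InnerProductSpace ℝ E]
    [FiniteDimensional ℝ E] [MeasurableSpace E] [BorelSpace E] (ρ : ℝ) : Measure E :=
  (volume : Measure E)[|Metric.closedBall 0 (Real.sqrt ρ)]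

lemma isProbabilityMeasure_uniformBall {ρ : ℝ} (hρ : 0 < ρ) :
    IsProbabilityMeasure (uniformBall E ρ) := by
  refine cond_isProbabilityMeasure_of_finite ?_ measure_closedBall_lt_top.ne
  exact (Metric.measure_closedBall_pos _ _ (Real.sqrt_pos.2 hρ)).ne'

lemma ae_mem_closedBall_uniformBall {ρ : ℝ} :
    ∀ᵐ x ∂(uniformBall E ρ), x ∈ Metric.closedBall (0 : E) (Real.sqrt ρ) :=
  ae_cond_mem Metric.isClosed_closedBall.measurableSet

lemma volume_closedBall_sqrt_inv_le {m : ℕ} (hm : 0 < m) (hE : Module.finrank ℝ E = 2 * m) {P : ℝ}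
    (hP : 0 < P) :
    (volume (Metric.closedBall (0 : E) (Real.sqrt ((2 * m : ℕ) * P))))⁻¹ ≤
      ENNReal.ofReal (Real.exp 1 * m * (2 * Real.pi * Real.exp 1 * P)⁻¹ ^ m) := by
  have hpi := Real.pi_pos
  have hm' : (0 : ℝ) < m := by positivity
  have : Nontrivial E := Module.nontrivial_of_finrank_pos (R := ℝ) (by omega)
  rw [InnerProductSpace.volume_closedBall_of_dim_even hE, hE,
    ← ENNReal.ofReal_pow (Real.sqrt_nonneg _), pow_mul, Real.sq_sqrt (by positivity),
    ← ENNReal.ofReal_mul (by positivity), ← ENNReal.ofReal_inv_of_pos (by positivity)]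
  apply ENNReal.ofReal_le_ofReal
  have hfac : (m.factorial : ℝ) ≤ Real.exp 1 * m * (m / Real.exp 1) ^ m := by
    obtain ⟨k, rfl⟩ : ∃ k, m = k + 1 := ⟨m - 1, by omega⟩
    -- The Stirling sequence decreases from its value `e / √2` at `1`.
    have h := Stirling.stirlingSeq'_antitone (Nat.zero_le k)
    simp only [Function.comp_apply, Nat.succ_eq_add_one, zero_add, Stirling.stirlingSeq_one] at h
    rw [Stirling.stirlingSeq, div_le_iff₀ (by positivity)] at h
    refine h.trans ?_
    rw [← mul_assoc]
    refine mul_le_mul_of_nonneg_right ?_ (by positivity)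
    rw [Real.sqrt_mul (by norm_num)]
    have h2 : (Real.sqrt 2) ≠ 0 := by positivity
    have h1 : Real.sqrt ((k + 1 : ℕ) : ℝ) ≤ (k + 1 : ℕ) := by
      rw [Real.sqrt_le_left (by positivity)]
      have : (1 : ℝ) ≤ (k + 1 : ℕ) := by norm_num
      nlinarith
    calc _ = Real.exp 1 * Real.sqrt ((k + 1 : ℕ) : ℝ) := by field_simp
      _ ≤ _ := by gcongr
  have e : ((((2 * m : ℕ) : ℝ) * P) ^ m * (Real.pi ^ m / (m.factorial : ℝ)))⁻¹ =
      m.factorial * (2 * m * P * Real.pi)⁻¹ ^ m := by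
    push_cast
    rw [inv_pow]
    simp only [mul_pow]
    field_simp
  rw [e]
  calc _ ≤ (Real.exp 1 * m * (m / Real.exp 1) ^ m) * (2 * m * P * Real.pi)⁻¹ ^ m := by gcongr
    _ = _ := by
      rw [mul_assoc, ← mul_pow]
      congr 2
      field_simp

/-- On the ball `1 ≤ exp (t * (ρ - ‖x‖ ^ 2))`; inserting this weight and completing the square
leaves a full Gaussian integral. -/
lemma lintegral_uniformBall_exp_le {m : ℕ} (hE : Module.finrank ℝ E = 2 * m) {ρ s t : ℝ}
    (hρ : 0 < ρ) (hs : 0 < s) (ht : 0 < t) (y : E) :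
    ∫⁻ x, ENNReal.ofReal (Real.exp (-s * ‖x - y‖ ^ 2)) ∂(uniformBall E ρ) ≤
      (volume (Metric.closedBall (0 : E) (Real.sqrt ρ)))⁻¹ *
        ENNReal.ofReal (Real.exp (t * ρ) * (Real.pi / (s + t)) ^ m *
          Real.exp (-(s * t / (s + t)) * ‖y‖ ^ 2)) := by
  have hpi := Real.pi_pos
  have hst : 0 < s + t := by positivity
  rw [uniformBall, ProbabilityTheory.cond, lintegral_smul_measure, smul_eq_mul]
  gcongr
  have key (x : E) : -(s + t) * ‖x - (s / (s + t)) • y‖ ^ 2 =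
      s * t / (s + t) * ‖y‖ ^ 2 - s * ‖x - y‖ ^ 2 - t * ‖x‖ ^ 2 := by
    rw [norm_sub_sq_real, norm_sub_sq_real, inner_smul_right, norm_smul, mul_pow, Real.norm_eq_abs,
      sq_abs]
    field_simp
    ring
  calc _ ≤ ∫⁻ x in Metric.closedBall (0 : E) (Real.sqrt ρ),
        ENNReal.ofReal (Real.exp (t * ρ) * Real.exp (-(s * t / (s + t)) * ‖y‖ ^ 2)) *
          ENNReal.ofReal (Real.exp (-(s + t) * ‖x - (s / (s + t)) • y‖ ^ 2)) := by
        refine setLIntegral_mono (by fun_prop) fun x hx ↦ ?_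
        rw [← ENNReal.ofReal_mul (by positivity), ← Real.exp_add, ← Real.exp_add, key]
        apply ENNReal.ofReal_le_ofReal
        apply Real.exp_le_exp.2
        have hx' : ‖x‖ ^ 2 ≤ ρ := by
          rw [mem_closedBall_zero_iff] at hx
          exact (Real.le_sqrt (norm_nonneg _) hρ.le).1 hx
        nlinarith
    _ ≤ ∫⁻ x : E, ENNReal.ofReal (Real.exp (t * ρ) * Real.exp (-(s * t / (s + t)) * ‖y‖ ^ 2)) *
          ENNReal.ofReal (Real.exp (-(s + t) * ‖x - (s / (s + t)) • y‖ ^ 2)) :=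
        setLIntegral_le_lintegral _ _
    _ = _ := by
        rw [lintegral_const_mul _ (by fun_prop), lintegral_exp_neg_mul_norm_sq hE hst,
          ← ENNReal.ofReal_mul (by positivity)]
        congr 1
        ring

/-- Chernoff bound for the spread of `L` independent uniform points of a ball. -/
lemma measure_spread_le {m L : ℕ} (hL : 0 < L) (hE : Module.finrank ℝ E = 2 * m) {ρ s t : ℝ}
    (hρ : 0 < ρ) (hs : 0 < s) (ht : 0 < t) (D : ℝ) :
    (Measure.pi fun _ : Fin L ↦ uniformBall E ρ) {x | spread x ≤ D} ≤
      (volume (Metric.closedBall (0 : E) (Real.sqrt ρ)))⁻¹ ^ L *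
        ENNReal.ofReal (Real.exp (s * D + L * (t * ρ)) *
          (Real.pi ^ L * (s + t) / (t * (s + t) ^ L)) ^ m) := by
  have hpi := Real.pi_pos
  have hst : 0 < s + t := by positivity
  have := isProbabilityMeasure_uniformBall (E := E) hρ
  set V := (volume (Metric.closedBall (0 : E) (Real.sqrt ρ)))⁻¹
  set μ := uniformBall E ρ
  have hL' : (0 : ℝ) < L := by positivity
  calc _ ≤ ∫⁻ x : Fin L → E, ENNReal.ofReal (Real.exp (s * D)) *
        ENNReal.ofReal (Real.exp (-s * spread x)) ∂(Measure.pi fun _ ↦ μ) := by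
        rw [← lintegral_indicator_one (measurableSet_le continuous_spread.measurable
          measurable_const)]
        refine lintegral_mono fun x ↦ ?_
        rw [Set.indicator_apply]
        split_ifs with hx
        swap
        · exact zero_le
        rw [← ENNReal.ofReal_mul (by positivity), ← Real.exp_add, Pi.one_apply,
          ENNReal.one_le_ofReal, Real.one_le_exp_iff]
        have : spread x ≤ D := hx
        nlinarith
    _ = ENNReal.ofReal (Real.exp (s * D)) * (ENNReal.ofReal ((s * L / Real.pi) ^ m) *
        ∫⁻ y : E, (∫⁻ x, ENNReal.ofReal (Real.exp (-s * ‖x - y‖ ^ 2)) ∂μ) ^ L) := by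
        simp_rw [exp_neg_spread_eq_lintegral hL hE hs]
        have hmeas : Measurable fun p : (Fin L → E) × E ↦
            ∏ i, ENNReal.ofReal (Real.exp (-s * ‖p.1 i - p.2‖ ^ 2)) := by fun_prop
        rw [lintegral_const_mul _ (hmeas.lintegral_prod_right'.const_mul _),
          lintegral_const_mul _ hmeas.lintegral_prod_right', lintegral_lintegral_swap
            hmeas.aemeasurable]
        congr 2
        refine lintegral_congr fun y ↦ ?_
        exact lintegral_pi_prod μ (f := fun x ↦ ENNReal.ofReal (Real.exp (-s * ‖x - y‖ ^ 2)))
          (by fun_prop)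
    _ ≤ ENNReal.ofReal (Real.exp (s * D)) * (ENNReal.ofReal ((s * L / Real.pi) ^ m) *
        ∫⁻ y : E, (V * ENNReal.ofReal (Real.exp (t * ρ) * (Real.pi / (s + t)) ^ m *
          Real.exp (-(s * t / (s + t)) * ‖y‖ ^ 2))) ^ L) := by
        gcongr with y
        exact lintegral_uniformBall_exp_le hE hρ hs ht y
    _ = ENNReal.ofReal (Real.exp (s * D)) * (ENNReal.ofReal ((s * L / Real.pi) ^ m) *
        (V ^ L * ENNReal.ofReal ((Real.exp (t * ρ) * (Real.pi / (s + t)) ^ m) ^ L) *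
          ENNReal.ofReal ((Real.pi / (L * (s * t / (s + t)))) ^ m))) := by
        congr 2
        rw [← lintegral_exp_neg_mul_norm_sq hE (a := L * (s * t / (s + t))) (by positivity) (0 : E),
          ← lintegral_const_mul _ (by fun_prop)]
        refine lintegral_congr fun y ↦ ?_
        rw [mul_pow V, mul_assoc (V ^ L), ← ENNReal.ofReal_pow (by positivity),
          ← ENNReal.ofReal_mul (by positivity)]
        congr 2
        rw [mul_pow _ (Real.exp _), ← Real.exp_nat_mul, sub_zero]
        ring_nf
    _ = V ^ L * ENNReal.ofReal (Real.exp (s * D) * ((s * L / Real.pi) ^ m *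
        ((Real.exp (t * ρ) * (Real.pi / (s + t)) ^ m) ^ L *
          (Real.pi / (L * (s * t / (s + t)))) ^ m))) := by
        rw [ENNReal.ofReal_mul (by positivity), ENNReal.ofReal_mul (by positivity),
          ENNReal.ofReal_mul (by positivity)]
        ring
    _ = _ := by
        congr 2
        rw [mul_pow, ← Real.exp_nat_mul, Real.exp_add, ← pow_mul, mul_comm m L, pow_mul]
        have : s * L / Real.pi * ((Real.pi / (s + t)) ^ L * (Real.pi / (L * (s * t / (s + t))))) =
            Real.pi ^ L * (s + t) / (t * (s + t) ^ L) := by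
          rw [div_pow]
          field_simp
        rw [← this, mul_pow, mul_pow]
        ring

end Spread

/-! ### Expurgation and passage from spread to packing. -/

lemma measurePreserving_pi_precomp {E ι κ : Type*} [Fintype ι] [Fintype κ] [MeasurableSpace E]
    (μ : Measure E) [IsProbabilityMeasure μ] (e : ι ↪ κ) :
    MeasurePreserving (fun (ω : κ → E) i ↦ ω (e i)) (Measure.pi fun _ ↦ μ)
      (Measure.pi fun _ ↦ μ) := by
  refine ⟨by fun_prop, ?_⟩
  have h := (iIndepFun_pi (μ := fun _ : κ ↦ μ) (X := fun _ ↦ id)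
    fun _ ↦ aemeasurable_id).precomp e.injective
  have h' := (iIndepFun_iff_map_fun_eq_pi_map (fun i ↦ aemeasurable_id.comp_measurable
    (measurable_pi_apply (e i)))).1 h
  simp only [id, Function.comp_def] at h'
  rw [h']
  congr with i : 1
  exact (measurePreserving_eval (fun _ : κ ↦ μ) (e i)).map_eq

/-- Expurgation of a random code: if an `L`-tuple of independent points is bad with small
probability, then some code of positive density of indices has no bad `L`-tuple. -/
lemma exists_expurgated {E : Type*} [MeasurableSpace E] (μ : Measure E) [IsProbabilityMeasure μ]
    {B : Set E} (hB : ∀ᵐ x ∂μ, x ∈ B) {L M : ℕ} (hL : 0 < L) {bad : Set (Fin L → E)}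
    (hbad : MeasurableSet bad)
    (hp : (M : ℝ≥0∞) ^ L * (Measure.pi fun _ ↦ μ) bad < M / 2) :
    ∃ (ω : Fin M → E) (I : Finset (Fin M)), (∀ i, ω i ∈ B) ∧ M ≤ 2 * #I ∧
      ∀ e : Fin L ↪ Fin M, (∀ i, e i ∈ I) → (fun i ↦ ω (e i)) ∉ bad := by
  classical
  -- The number of bad tuples of distinct indices; its mean is below `M / 2`.
  set h : (Fin M → E) → ℝ≥0∞ := fun ω ↦
    ∑ e : Fin L ↪ Fin M, bad.indicator 1 (fun i ↦ ω (e i)) with hh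
  have hint : ∫⁻ ω, h ω ∂(Measure.pi fun _ ↦ μ) < M / 2 := by
    refine lt_of_le_of_lt ?_ hp
    rw [lintegral_finsetSum (f := fun (e : Fin L ↪ Fin M) (ω : Fin M → E) ↦
      bad.indicator (1 : (Fin L → E) → ℝ≥0∞) (fun i ↦ ω (e i))) _ fun e _ ↦
      (measurable_one.indicator hbad).comp (measurePreserving_pi_precomp μ e).measurable]
    have (e : Fin L ↪ Fin M) : ∫⁻ ω, bad.indicator (1 : (Fin L → E) → ℝ≥0∞) (fun i ↦ ω (e i))
        ∂(Measure.pi fun _ ↦ μ) = (Measure.pi fun _ ↦ μ) bad := by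
      rw [(measurePreserving_pi_precomp μ e).lintegral_comp (measurable_one.indicator hbad),
        lintegral_indicator_one hbad]
    simp_rw [this]
    rw [sum_const, nsmul_eq_mul, card_univ, Fintype.card_embedding_eq]
    gcongr
    simpa using Nat.cast_le (α := ℝ≥0∞).2 (Nat.descFactorial_le_pow (Fintype.card (Fin M)) L)
  have hae : ∀ᵐ ω ∂(Measure.pi fun _ : Fin M ↦ μ), ∀ i, ω i ∈ B :=
    ae_all_iff.2 fun i ↦ (measurePreserving_eval (fun _ : Fin M ↦ μ) i).quasiMeasurePreserving.ae hB
  obtain ⟨ω, hωB, hω⟩ : ∃ ω : Fin M → E, (∀ i, ω i ∈ B) ∧ h ω < M / 2 := by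
    by_contra! hcon
    refine hint.not_ge ?_
    calc (M / 2 : ℝ≥0∞) = ∫⁻ ω, M / 2 ∂(Measure.pi fun _ : Fin M ↦ μ) := by simp
      _ ≤ _ := lintegral_mono_ae (hae.mono fun ω hω ↦ hcon ω hω)
  set F : Finset (Fin L ↪ Fin M) := {e | (fun i ↦ ω (e i)) ∈ bad}
  have hF : h ω = #F := by
    simp [hh, F, Set.indicator_apply]
  have hF2 : 2 * #F ≤ M := by
    rw [hF, ENNReal.lt_div_iff_mul_lt (by simp) (by simp)] at hω
    have : #F * 2 < M := by exact_mod_cast hω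
    omega
  -- Deleting the first index of every bad tuple destroys them all.
  refine ⟨ω, (F.image fun e ↦ e ⟨0, hL⟩)ᶜ, hωB, ?_, fun e he hb ↦ ?_⟩
  · have h1 := card_compl_add_card (F.image fun e ↦ e ⟨0, hL⟩)
    have h2 : #(F.image fun e ↦ e ⟨0, hL⟩) ≤ #F := card_image_le
    rw [Fintype.card_fin] at h1
    omega
  · have := he ⟨0, hL⟩
    rw [mem_compl, mem_image] at this
    exact this ⟨e, by simpa [F] using hb, rfl⟩

lemma isMultiplePacking_image {n L M : ℕ} (hL : 0 < L) {P N : ℝ} (hN : 0 ≤ N)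
    {ω : Fin M → EuclideanSpace ℝ (Fin n)} {I : Finset (Fin M)}
    (hω : ∀ i, ω i ∈ Metric.closedBall 0 (Real.sqrt (n * P)))
    (hI : ∀ e : Fin L ↪ Fin M, (∀ i, e i ∈ I) → L * (n * N) < spread fun i ↦ ω (e i)) :
    IsMultiplePacking P N L (ω '' I) := by
  have hL' : (0 : ℝ) < L := by positivity
  refine ⟨by rintro _ ⟨i, -, rfl⟩; exact hω i, ?_⟩
  -- An infimum can lose strictness; as there are finitely many tuples, one margin `c` serves them
  -- all.
  obtain ⟨c, hc, hcI⟩ : ∃ c : ℝ, n * N < c ∧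
      ∀ e : Fin L ↪ Fin M, (∀ i, e i ∈ I) → L * c < spread fun i ↦ ω (e i) := by
    have h1 : ∀ᶠ c in nhdsWithin (n * N) (Set.Ioi (n * N)),
        ∀ e : Fin L ↪ Fin M, (∀ i, e i ∈ I) → L * c < spread fun i ↦ ω (e i) := by
      refine Filter.eventually_all.2 fun e ↦ ?_
      by_cases he : ∀ i, e i ∈ I
      · have : Filter.Tendsto (fun c : ℝ ↦ L * c) (nhdsWithin (n * N) (Set.Ioi (n * N)))
            (nhds (L * (n * N))) :=
          ((continuous_const_mul (L : ℝ)).tendsto _).mono_left nhdsWithin_le_nhds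
        filter_upwards [this.eventually_lt_const (hI e he)] with c hc _ using hc
      · exact .of_forall fun _ h ↦ absurd h he
    obtain ⟨c, hc', hc⟩ := (h1.and (eventually_mem_nhdsWithin (a := (n * N : ℝ)))).exists
    exact ⟨c, hc, hc'⟩
  refine lt_of_lt_of_le ((ENNReal.ofReal_lt_ofReal_iff_of_nonneg (by positivity)).2 hc) ?_
  refine le_iInf fun S ↦ le_iInf fun hS ↦ le_iInf fun hSL ↦ le_iInf fun y ↦ ?_
  let g := S.equivFinOfCardEq hSL
  choose f hf hfω using fun i : Fin L ↦ hS (g.symm i).2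
  have hinj : Function.Injective f := fun i j hij ↦ by
    apply g.symm.injective
    rw [Subtype.ext_iff, ← hfω, ← hfω, hij]
  obtain ⟨i, hi⟩ : ∃ i, c ≤ ‖ω (f i) - y‖ ^ 2 := by
    by_contra! hcon
    have h1 := hcI ⟨f, hinj⟩ hf
    have h2 := sum_norm_sub_sq hL (fun i ↦ ω (f i)) y
    have h3 : ∑ i, ‖ω (f i) - y‖ ^ 2 ≤ ∑ _i : Fin L, c := sum_le_sum fun i _ ↦ (hcon i).le
    simp only [sum_const, card_univ, Fintype.card_fin, nsmul_eq_mul] at h3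
    have h4 : 0 ≤ (L : ℝ) * ‖y - (L : ℝ)⁻¹ • ∑ j, ω (f j)‖ ^ 2 := by positivity
    simp only [Function.Embedding.coeFn_mk] at h1
    linarith
  refine (ENNReal.ofReal_le_ofReal hi).trans ?_
  rw [hfω]
  exact le_iSup₂ (f := fun x (_ : x ∈ S) ↦ ENNReal.ofReal (‖x - y‖ ^ 2)) _ (g.symm i).2

/-- Codewords may coincide, but `L` equal ones would have spread zero. -/
lemma card_le_mul_card_image_of_spread_pos {E : Type*} [NormedAddCommGroup E]
    [InnerProductSpace ℝ E] [DecidableEq E] {L M : ℕ} (hL : 0 < L) {ω : Fin M → E}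
    {I : Finset (Fin M)}
    (hI : ∀ e : Fin L ↪ Fin M, (∀ i, e i ∈ I) → 0 < spread fun i ↦ ω (e i)) :
    #I ≤ L * #(I.image ω) := by
  refine card_le_mul_card_image I L fun b _ ↦ ?_
  by_contra! hcard
  obtain ⟨e⟩ : Nonempty (Fin L ↪ {a // a ∈ I.filter fun a ↦ ω a = b}) :=
    Function.Embedding.nonempty_of_card_le (by
      rw [Fintype.card_fin, Fintype.card_coe]
      exact hcard.le)
  have he (i : Fin L) := (mem_filter.1 (e i).2)
  have h1 := hI (e.trans (Function.Embedding.subtype _)) fun i ↦ (he i).1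
  have h2 := sum_norm_sub_sq hL (fun i ↦ ω (e.trans (Function.Embedding.subtype _) i)) b
  have h3 : ∑ i, ‖ω (e.trans (Function.Embedding.subtype _) i) - b‖ ^ 2 = 0 :=
    sum_eq_zero fun i _ ↦ by simp [(he i).2]
  rw [h3] at h2
  have h4 : 0 ≤ (L : ℝ) * ‖b - (L : ℝ)⁻¹ • ∑ j,
    ω (e.trans (Function.Embedding.subtype _) j)‖ ^ 2 := by positivity
  linarith

/-! ### Optimized exponent and achievable rate. -/

/-- The Chernoff bound for the spread with optimized parameters. -/
lemma measure_spread_le_pow {E : Type*} [NormedAddCommGroup E] [InnerProductSpace ℝ E]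
    [FiniteDimensional ℝ E] [MeasurableSpace E] [BorelSpace E] {m L : ℕ} (hm : 0 < m) (hL : 0 < L)
    (hE : Module.finrank ℝ E = 2 * m) {P N A B : ℝ} (hP : 0 < P) (hB : 0 < B) (hBA : B < A)
    (hAB : A * N + B * (P - N) = P) :
    (Measure.pi fun _ : Fin L ↦ uniformBall E ((2 * m : ℕ) * P))
      {x | spread x ≤ L * ((2 * m : ℕ) * N)} ≤
        ENNReal.ofReal ((Real.exp 1 * m) ^ L * (A / (B * A ^ L)) ^ m) := by
  have hpi := Real.pi_pos
  have hA : 0 < A := hB.trans hBA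
  have hm' : (0 : ℝ) < m := by positivity
  -- For the `A`, `B` of the main theorem these `s`, `t` minimize the bound. By `hAB` the exponent
  -- is `m * L`, which cancels the `e` from Stirling.
  refine (measure_spread_le hL hE (s := (A - B) / (2 * P)) (t := B / (2 * P)) (by positivity)
    (by have := sub_pos.2 hBA; positivity) (by positivity) _).trans ?_
  refine (mul_le_mul_left (pow_le_pow_left' (volume_closedBall_sqrt_inv_le hm hE hP) L) _).trans ?_
  rw [← ENNReal.ofReal_pow (by positivity), ← ENNReal.ofReal_mul (by positivity)]
  apply le_of_eq
  congr 1
  have hst : (A - B) / (2 * P) + B / (2 * P) = A / (2 * P) := by ring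
  have hexp : (A - B) / (2 * P) * (L * ((2 * m : ℕ) * N)) +
      L * (B / (2 * P) * ((2 * m : ℕ) * P)) = m * (L * 1) := by
    push_cast
    field_simp
    linarith
  rw [hst, hexp, Real.exp_nat_mul, Real.exp_nat_mul, mul_pow (_ * _), pow_right_comm, mul_assoc,
    ← mul_pow, ← mul_pow]
  congr 2
  simp only [inv_pow, mul_pow, div_pow]
  field_simp

/-- Below the threshold rate, codes of even block length achieve the rate. -/
lemma eventually_exists_code {L : ℕ} (hL : 2 ≤ L) {P N A B R : ℝ} (hP : 0 < P) (hN : 0 ≤ N)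
    (hB : 0 < B) (hBA : B < A) (hAB : A * N + B * (P - N) = P) (hR : 0 ≤ R)
    (hRAB : Real.exp (2 * R) ^ (L - 1) < B * A ^ (L - 1)) :
    ∀ᶠ m : ℕ in Filter.atTop, ∃ C : Set (EuclideanSpace ℝ (Fin (2 * m))),
      IsMultiplePacking P N L C ∧ (R : EReal) ≤ rate C := by
  classical
  have hA : 0 < A := hB.trans hBA
  obtain ⟨k, rfl⟩ : ∃ k, L = k + 1 := ⟨L - 1, by omega⟩
  rw [Nat.add_sub_cancel] at hRAB
  set L := k + 1 with hLk
  set r := Real.exp (2 * R) ^ k * (B * A ^ k)⁻¹ with hr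
  have hr1 : r < 1 := by
    rw [hr, ← div_eq_mul_inv, div_lt_one (by positivity)]
    exact hRAB
  have hlim := (tendsto_pow_const_mul_const_pow_of_lt_one L (by positivity) hr1).const_mul
    ((3 * L : ℝ) ^ k * Real.exp 1 ^ L)
  rw [mul_zero] at hlim
  filter_upwards [hlim.eventually_lt_const (show (0 : ℝ) < 1 / 2 by norm_num),
    Filter.eventually_gt_atTop 0] with m hm hm0
  have hm0' : (0 : ℝ) < m := by positivity
  set x := Real.exp ((2 * m : ℕ) * R) with hx
  have hx1 : 1 ≤ x := Real.one_le_exp (by positivity)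
  have hL1 : (1 : ℝ) ≤ L := by rw [hLk]; simp
  -- The factor `2` pays for expurgation, `L` for coinciding codewords.
  set M := ⌈2 * L * x⌉₊ with hM
  have hM1 : 2 * L * x ≤ M := Nat.le_ceil _
  have hM2 : (M : ℝ) ≤ 3 * L * x := by
    have := (Nat.ceil_lt_add_one (show 0 ≤ 2 * L * x by positivity)).le
    nlinarith
  have hMpos : (0 : ℝ) < M := lt_of_lt_of_le (by positivity) hM1
  have hρ : 0 < ((2 * m : ℕ) : ℝ) * P := by push_cast; positivity
  have hE : Module.finrank ℝ (EuclideanSpace ℝ (Fin (2 * m))) = 2 * m := by simp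
  have := isProbabilityMeasure_uniformBall (E := EuclideanSpace ℝ (Fin (2 * m))) hρ
  have hp : (M : ℝ≥0∞) ^ L * (Measure.pi fun _ : Fin L ↦
      uniformBall (EuclideanSpace ℝ (Fin (2 * m))) ((2 * m : ℕ) * P))
        {x | spread x ≤ L * ((2 * m : ℕ) * N)} < M / 2 := by
    refine lt_of_le_of_lt (mul_le_mul_right (measure_spread_le_pow hm0 (by omega) hE hP hB hBA hAB)
      _) ?_
    rw [← ENNReal.ofReal_natCast, ← ENNReal.ofReal_pow (by positivity),
      ← ENNReal.ofReal_mul (by positivity),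
      show (2 : ℝ≥0∞) = ENNReal.ofReal 2 by simp, ← ENNReal.ofReal_div_of_pos (by norm_num)]
    refine (ENNReal.ofReal_lt_ofReal_iff (by positivity)).2 ?_
    have hxr : x ^ k * (A / (B * A ^ L)) ^ m = r ^ m := by
      have e1 : x ^ k = (Real.exp (2 * R) ^ k) ^ m := by
        rw [hx, pow_right_comm, ← Real.exp_nat_mul (2 * R) m]
        push_cast
        ring_nf
      rw [e1, ← mul_pow, hr, hLk]
      congr 2
      field_simp
      ring
    calc (M : ℝ) ^ L * ((Real.exp 1 * m) ^ L * (A / (B * A ^ L)) ^ m)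
        = M * (M ^ k * ((Real.exp 1 * m) ^ L * (A / (B * A ^ L)) ^ m)) := by rw [hLk]; ring
      _ ≤ M * ((3 * L * x) ^ k * ((Real.exp 1 * m) ^ L * (A / (B * A ^ L)) ^ m)) := by gcongr
      _ = M * ((3 * L : ℝ) ^ k * Real.exp 1 ^ L * (m ^ L * r ^ m)) := by
        rw [← hxr, mul_pow _ x, mul_pow (Real.exp 1)]
        ring
      _ < M * (1 / 2) := by gcongr
      _ = M / 2 := by ring
  obtain ⟨ω, I, hω, hMI, hgood⟩ := exists_expurgated _ ae_mem_closedBall_uniformBall (by omega)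
    (measurableSet_le continuous_spread.measurable measurable_const) hp
  have hgood' (e : Fin L ↪ Fin M) (he : ∀ i, e i ∈ I) :
      L * ((2 * m : ℕ) * N) < spread fun i ↦ ω (e i) := not_le.1 (hgood e he)
  refine ⟨ω '' I, isMultiplePacking_image (by omega) hN hω hgood', ?_⟩
  have hcard := card_le_mul_card_image_of_spread_pos (by omega) fun e he ↦
    lt_of_le_of_lt (by positivity) (hgood' e he)
  have hxcard : x ≤ #(I.image ω) := by
    have h1 : (M : ℝ) ≤ 2 * (L * #(I.image ω)) := by exact_mod_cast hMI.trans (by omega)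
    have h2 : L * x ≤ L * #(I.image ω) := by linarith
    exact le_of_mul_le_mul_left h2 (by positivity)
  rw [rate, ← coe_image, Set.encard_coe_eq_coe_finsetCard,
    EReal.le_div_iff_mul_le (by exact_mod_cast (by omega : 0 < 2 * m)) (EReal.natCast_ne_top _)]
  calc (R : EReal) * ((2 * m : ℕ) : EReal) = ((((2 * m : ℕ) : ℝ) * R : ℝ) : EReal) := by
        rw [mul_comm, EReal.coe_mul]; rfl
    _ = ENNReal.log (ENNReal.ofReal x) := by
        rw [ENNReal.log_ofReal_of_pos (by positivity), hx, Real.log_exp]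
    _ ≤ _ := by
        gcongr
        rw [ENat.toENNReal_coe, ← ENNReal.ofReal_natCast]
        exact ENNReal.ofReal_le_ofReal hxcard

/-- A single point is a packing of rate zero; this settles negative target rates. -/
lemma capacity_nonneg {P N : ℝ} {L : ℕ} (hL : 2 ≤ L) : 0 ≤ capacity P N L := by
  refine Filter.le_limsup_of_frequently_le' (Filter.Frequently.of_forall fun n ↦ ?_)
  refine le_iSup₂_of_le {0} ⟨by simpa using by positivity, ?_⟩ (by simp [rate])
  have : listRadSq L ({0} : Set (EuclideanSpace ℝ (Fin n))) = ⊤ := by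
    refine iInf_eq_top.2 fun S ↦ iInf_eq_top.2 fun hS ↦ iInf_eq_top.2 fun hSL ↦ ?_
    have : S ⊆ {0} := by exact_mod_cast hS
    have := card_le_card this
    simp at this
    omega
  rw [this]
  exact ENNReal.ofReal_lt_top

end MultiplePacking

theorem mainTheorem1 (P N : ℝ) (L : ℕ) (hP : 0 < P) (hN : 0 < N) (hL : 2 ≤ L)
    (hNP : N ≤ ((L : ℝ) - 1) / (L : ℝ) * P) :
    (((1 / 2 : ℝ) *
        (Real.log (((L : ℝ) - 1) * P / ((L : ℝ) * N)) +
          1 / ((L : ℝ) - 1) * Real.log (P / ((L : ℝ) * (P - N)))) : ℝ) : EReal) ≤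
      MultiplePacking.capacity P N L := by
  have hL2 : (2 : ℝ) ≤ L := by exact_mod_cast hL
  have hL1 : (0 : ℝ) < (L : ℝ) - 1 := by linarith
  have hL0 : (0 : ℝ) < L := by linarith
  have hNP' : L * N ≤ (L - 1) * P := by
    rw [div_mul_eq_mul_div, le_div_iff₀ hL0] at hNP
    linarith
  have hPN : 0 < P - N := by nlinarith
  refine EReal.ge_of_forall_gt_iff_ge.1 fun R hR ↦ ?_
  rw [EReal.coe_lt_coe_iff] at hR
  rcases lt_or_ge R 0 with hR0 | hR0
  · exact le_trans (by exact_mod_cast hR0.le) (MultiplePacking.capacity_nonneg hL)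
  set A := ((L : ℝ) - 1) * P / (L * N) with hA
  set B := P / ((L : ℝ) * (P - N)) with hB
  have hA0 : 0 < A := by positivity
  have hB0 : 0 < B := by positivity
  have hBA : B < A := by
    -- At equality `A = B = 1` and the bound is `0`, contradicting `0 ≤ R`.
    rcases hNP'.eq_or_lt with h | h
    · have hA1 : A = 1 := by rw [hA, h]; exact div_self (by positivity)
      have hB1 : B = 1 := by rw [hB, show (L : ℝ) * (P - N) = P by linarith]; exact div_self hP.ne'
      rw [hA1, hB1] at hR
      simp at hR
      linarith
    · rw [hA, hB, div_lt_div_iff₀ (by positivity) (by positivity)]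
      nlinarith [mul_pos (mul_pos hP hL0) (sub_pos.2 h)]
  have hAB : A * N + B * (P - N) = P := by
    rw [hA, hB]
    field_simp
    ring
  have hRAB : Real.exp (2 * R) ^ (L - 1) < B * A ^ (L - 1) := by
    rw [← Real.log_lt_log_iff (by positivity) (by positivity), Real.log_pow, Real.log_exp,
      Real.log_mul (by positivity) (by positivity), Real.log_pow, Nat.cast_sub (by omega)]
    have h1 : (L - 1) * (1 / 2 * (Real.log A + 1 / (L - 1) * Real.log B)) =
      1 / 2 * ((L - 1) * Real.log A + Real.log B) := by field_simp
    have h2 := mul_lt_mul_of_pos_left hR hL1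
    push_cast
    linarith
  obtain ⟨m₀, hm₀⟩ := Filter.eventually_atTop.1
    (MultiplePacking.eventually_exists_code hL hP hN.le hB0 hBA hAB hR0 hRAB)
  -- For a limsup, even dimensions suffice.
  refine Filter.le_limsup_of_frequently_le' (Filter.frequently_atTop.2 fun a ↦ ?_)
  obtain ⟨C, hC, hRC⟩ := hm₀ (max a m₀) (le_max_right _ _)
  exact ⟨2 * max a m₀, by have := le_max_left a m₀; omega, le_iSup₂_of_le C hC hRC⟩
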